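/- Let $X$ be a finite-dimensional real vector space, equipped with an auxiliary Euclidean structure, which fixes Lebesgue measure on $X$ and identifies $X^*$ with $X$. For a finite-dimensional real vector space $E$, let $\mathbb S_E$ be the set of half-lines $\{ra : r>0\}$, $0\ne a\in E$. For $u:E\to\mathbb C$, $\alpha\in\mathbb S_E$ and $c\in\mathbb C$, write $\lim_{\alpha}u=c$ if for every neighbourhood $V$ of $c$ there is an open truncated cone $C$ (a set stable under multiplication by positive reals, minus a bounded set) and some $a\in\alpha$ with $ra\in C$ for all $r\ge 1$, such that $u(x)\in V$ for all $x\in C$. Let $\mathcal C(\overline E)$ be the algebra of continuous functions $u:E\to\mathbb C$ for which $\lim_\alpha u$ exists for every $\alpha\in\mathbb S_E$ (the continuous functions on the spherical compactification of $E$). For a linear subspace $Y\subset X$ with projection $\pi_Y:X\to X/Y$, identify $v\in\mathcal C(\overline{X/Y})$ with the function $v\circ\pi_Y$ on $X$. Let $\mathcal E(X)$ be the $C^*$-subalgebra of the bounded continuous functions on $X$ (sup norm) generated by all $\mathcal C(\overline{X/Y})$, where $Y$ runs over all linear subspaces of $X$. On $L^2(X)$ let $u(q)$ be multiplication by $u$,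 let $v(p)=\mathcal F^{-1}v(q)\mathcal F$ with $\mathcal F$ the Fourier transform, and let $(T_xf)(y)=f(y-x)$. Let $\mathscr E(X)=\mathcal E(X)\rtimes X$ be the norm closed linear span, in the bounded operators on $L^2(X)$, of the operators $u(q)v(p)$ with $u\in\mathcal E(X)$ and $v\in\mathcal C_0(X^*)$. 1. Let $A\in\mathscr E(X)$. For each $\alpha\in\mathbb S_X$ the strong limit $\tau_\alpha(A)=\operatorname{s-lim}_{r\to+\infty}T_{ra}^*AT_{ra}$ ($a\in\alpha$) exists, does not depend on the choice of $a\in\alpha$, and belongs to $\mathscr E(X)$; and the set $\{\tau_\alpha(A):\alpha\in\mathbb S_X\}$ is relatively compact in $\mathscr E(X)$ for the norm topology. 2. This set is not compact in general: for $X=\mathbb R^2$ and $Y=\{0\}\times\mathbb R$ there are $u_0\in\mathcal C(\overline X)$ and $u_Y\in\mathcal C(\overline{X/Y})$ such that, for every nonzero $v\in\mathcal C_0(X^*)$, the operator $A=(u_0+u_Y)(q)\,v(p)$ belongs to $\mathscr E(X)$ and $\{\tau_\alpha(A):\alpha\in\mathbb S_X\}$ is not compact. -/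

import Mathlib

open MeasureTheory Filter Topology BoundedContinuousFunction
open scoped ENNReal ZeroAtInfty

noncomputable section

namespace NBody

/-! ### The sphere at infinity and the spherical compactification -/

section Sphere

variable {E : Type*} [SeminormedAddCommGroup E] [NormedSpace ℝ E]

/-- The open half-line `{r a : r > 0}` generated by `a`. -/
def halfLine (a : E) : Set E := {x | ∃ r : ℝ, 0 < r ∧ x = r • a}

variable (E) in
/-- The sphere at infinity `𝕊_E`: the set of all half-lines generated by nonzero vectors. -/
def SphereAtInfinity : Type _ := {α : Set E // ∃ a : E, a ≠ 0 ∧ α = halfLine a}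

/-- A cone is a set stable under multiplication by positive reals. -/
def IsCone (K : Set E) : Prop := ∀ x ∈ K, ∀ r : ℝ, 0 < r → r • x ∈ K

/-- A truncated cone is the intersection of a cone with the complement of a bounded set. -/
def IsTruncatedCone (C : Set E) : Prop :=
  ∃ K B : Set E, IsCone K ∧ Bornology.IsBounded B ∧ C = K \ B

/-- The half-line `α` is eventually in `C`. -/
def EventuallyIn (α : SphereAtInfinity E) (C : Set E) : Prop :=
  ∃ a ∈ α.1, ∀ r : ℝ, 1 ≤ r → r • a ∈ C

/-- `lim_{x → α} u(x) = c` in the sense of the topology of the spherical compactification of `E`,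
whose neighbourhoods of `α` have as traces on `E` the sets containing an open truncated cone in
which `α` eventually lies. -/
def HasSphericalLimit (u : E → ℂ) (α : SphereAtInfinity E) (c : ℂ) : Prop :=
  ∀ V ∈ 𝓝 c, ∃ C : Set E,
    IsOpen C ∧ IsTruncatedCone C ∧ EventuallyIn α C ∧ ∀ x ∈ C, u x ∈ V

variable (E) in
/-- The algebra `C(Ē)` of continuous functions on the spherical compactification `Ē` of `E`,
viewed as functions on `E`. -/
def sphericalFunctions : Set (E → ℂ) :=
  {u | Continuous u ∧ ∀ α : SphereAtInfinity E, ∃ c : ℂ, HasSphericalLimit u α c}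

/-- `C(\overline{E/Y})` as a set of functions on `E`: the functions `v ∘ π_Y`, where `π_Y` is the
projection of `E` onto `E/Y` and `v` is continuous on the spherical compactification of `E/Y`. -/
def quotientFunctions (Y : Submodule ℝ E) : Set (E →ᵇ ℂ) :=
  {f | ∃ v ∈ sphericalFunctions (E ⧸ Y), ∀ x, f x = v (Y.mkQ x)}

variable (E) in
/-- The algebra of elementary interactions: the C*-subalgebra of the bounded continuous functions
(with the sup norm) generated by the `C(\overline{E/Y})`, for all linear subspaces `Y`. -/
def interactionAlgebra : StarSubalgebra ℂ (E →ᵇ ℂ) :=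
  (StarAlgebra.adjoin ℂ (⋃ Y : Submodule ℝ E, quotientFunctions Y)).topologicalClosure

end Sphere

/-! ### Operators on `L²(X)` -/

section Operators

variable (X : Type*) [NormedAddCommGroup X] [InnerProductSpace ℝ X] [FiniteDimensional ℝ X]
  [MeasurableSpace X] [BorelSpace X]

/-- The Hilbert space `L²(X)`. -/
abbrev L2 : Type _ := Lp (α := X) ℂ 2 volume

variable {X}

theorem memLp_mul (u : X →ᵇ ℂ) (f : L2 X) :
    MemLp (fun x => u x * f x) 2 (volume : Measure X) :=
  (Lp.memLp f).of_le_mul (c := ‖u‖)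
    (u.continuous.aestronglyMeasurable.mul (Lp.aestronglyMeasurable f))
    (Eventually.of_forall fun x => by
      rw [norm_mul]
      exact mul_le_mul_of_nonneg_right (u.norm_coe_le_norm x) (norm_nonneg _))

/-- The operator `u(q)` of multiplication by the bounded continuous function `u` on `L²(X)`. -/
def positionOp (u : X →ᵇ ℂ) : L2 X →L[ℂ] L2 X :=
  LinearMap.mkContinuous
    { toFun := fun f => (memLp_mul u f).toLp _
      map_add' := fun f g => by
        rw [← MemLp.toLp_add]
        apply MemLp.toLp_congr
        filter_upwards [Lp.coeFn_add f g] with x hx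
        rw [hx, Pi.add_apply, Pi.add_apply, mul_add]
      map_smul' := fun c f => by
        rw [RingHom.id_apply, ← MemLp.toLp_const_smul]
        apply MemLp.toLp_congr
        filter_upwards [Lp.coeFn_smul c f] with x hx
        rw [hx, Pi.smul_apply, Pi.smul_apply, smul_eq_mul, smul_eq_mul, mul_left_comm] }
    ‖u‖
    (fun f => by
      apply Lp.norm_le_mul_norm_of_ae_le_mul
      filter_upwards [(memLp_mul u f).coeFn_toLp] with x hx
      simp only [LinearMap.coe_mk, AddHom.coe_mk]
      rw [hx, norm_mul]
      exact mul_le_mul_of_nonneg_right (u.norm_coe_le_norm x) (norm_nonneg _))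

theorem coeFn_positionOp (u : X →ᵇ ℂ) (f : L2 X) :
    positionOp u f =ᵐ[volume] fun x => u x * f x :=
  (memLp_mul u f).coeFn_toLp

/-- The operator `v(p) = F⁻¹ v(q) F`, where `F` is the Fourier transform on `L²(X)`; the dual of
`X` is identified with `X` through the inner product. -/
def momentumOp (v : C₀(X, ℂ)) : L2 X →L[ℂ] L2 X :=
  ((Lp.fourierTransformₗᵢ X ℂ).symm.toContinuousLinearEquiv : L2 X →L[ℂ] L2 X) ∘L
    positionOp v.toBCF ∘L
      ((Lp.fourierTransformₗᵢ X ℂ).toContinuousLinearEquiv : L2 X →L[ℂ] L2 X)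

/-- The translation operator `(T_x f)(y) = f(y - x)` on `L²(X)`. -/
def translationOp (x : X) : L2 X →L[ℂ] L2 X :=
  (Lp.compMeasurePreservingₗᵢ ℂ (fun y : X => y - x)
    (measurePreserving_sub_right volume x)).toContinuousLinearMap

variable (X) in
/-- The Hamiltonian algebra, i.e. the crossed product of the algebra of elementary interactions
by the action of `X` by translations, realized on `L²(X)`: the norm closed linear span of the
operators `u(q) v(p)` with `u` an elementary interaction and `v` in `C₀` of the dual of `X`. -/
def hamiltonianAlgebra : Submodule ℂ (L2 X →L[ℂ] L2 X) :=
  (Submodule.span ℂ {B | ∃ u ∈ interactionAlgebra X, ∃ v : C₀(X, ℂ),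
    B = positionOp u ∘L momentumOp v}).topologicalClosure

/-- `B` is the strong limit of `T_{ra}^* A T_{ra}` as `r → +∞`, for every `a ∈ α`. -/
def IsTranslationAtInfinity (α : SphereAtInfinity X) (A B : L2 X →L[ℂ] L2 X) : Prop :=
  ∀ a ∈ α.1, ∀ f : L2 X,
    Tendsto (fun r : ℝ =>
      (ContinuousLinearMap.adjoint (translationOp (r • a)) ∘L A ∘L translationOp (r • a)) f)
      atTop (𝓝 (B f))

open Classical in
/-- `τ_α(A)`, the strong limit of `T_{ra}^* A T_{ra}` as `r → +∞` with `a ∈ α` (and `0` if the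
limit does not exist or depends on `a ∈ α`). -/
def translationAtInfinity (α : SphereAtInfinity X) (A : L2 X →L[ℂ] L2 X) : L2 X →L[ℂ] L2 X :=
  if h : ∃ B, IsTranslationAtInfinity α A B then h.choose else 0

end Operators

/-- The vertical axis `{0} × ℝ` of the Euclidean plane. -/
def verticalAxis : Submodule ℝ (EuclideanSpace ℝ (Fin 2)) where
  carrier := {x | x 0 = 0}
  add_mem' := fun {x y} hx hy => by
    simp only [Set.mem_ofPred_eq] at hx hy ⊢
    simp [hx, hy]
  zero_mem' := by simp
  smul_mem' := fun c x hx => by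
    simp only [Set.mem_ofPred_eq] at hx ⊢
    simp [hx]

end NBody

end

/-! Since `v(p)` commutes with translations, conjugating `u(q)v(p)` by `T_x` only replaces `u` by
its translate `u(· + x)`. By dominated convergence, the strong limits on these operators reduce to
pointwise limits of `u(x + ra)` as `r → ∞`. For `u` in `C(\overline{X/Y})` there are two cases: if
`a ∈ Y` the translates equal `u`, otherwise they converge to a constant of modulus at most `‖u‖`.
All limits of a generator thus lie in a compact set, `{u}` together with a disc of constants. Total
boundedness survives algebraic operations because these are continuous, and norm limits because
passing to the limit along a ray is a contraction (`HasTotallyBoundedLimits.of_mem_closure`). This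
closure argument is used twice, for functions and then for operators. For non-compactness, take
`‖π_Y x‖ / (1 + ‖x‖)` plus `1 / (1 + ‖π_Y x‖)`. In a direction `a ∉ Y` the limit is `(‖π_Y a‖ / ‖a‖)
v(p)`, which is nonzero but tends to `0` as `a` approaches a nonzero vector of `Y`. In a direction
inside `Y` it is the second summand times `v(p)`, nonzero since that summand vanishes nowhere. So
`0` is in the closure of the set but not in the set. -/

noncomputable section

namespace NBody

section Translate

variable {E : Type*} [SeminormedAddCommGroup E]

/-- The translate `y ↦ u (y + x)` of a bounded continuous function. -/
def translate (x : E) (u : E →ᵇ ℂ) : E →ᵇ ℂ :=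
  u.compContinuous ⟨fun y => y + x, by fun_prop⟩

@[simp]
theorem translate_apply (x : E) (u : E →ᵇ ℂ) (y : E) : translate x u y = u (y + x) := rfl

theorem norm_translate_le (x : E) (u : E →ᵇ ℂ) : ‖translate x u‖ ≤ ‖u‖ :=
  norm_compContinuous_le _ _

end Translate

/-! ### Translations, multiplication operators and the Fourier transform on `L²(X)`. -/

section Operators

variable {X : Type*} [NormedAddCommGroup X] [InnerProductSpace ℝ X] [FiniteDimensional ℝ X]
  [MeasurableSpace X] [BorelSpace X]

open scoped FourierTransform

theorem positionOp_add (u w : X →ᵇ ℂ) : positionOp (u + w) = positionOp u + positionOp w := by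
  ext1 f
  apply Lp.ext
  filter_upwards [coeFn_positionOp (u + w) f, coeFn_positionOp u f, coeFn_positionOp w f,
    Lp.coeFn_add (positionOp u f) (positionOp w f)] with x h₁ h₂ h₃ h₄
  rw [_root_.add_apply, h₄, Pi.add_apply, h₁, h₂, h₃, BoundedContinuousFunction.add_apply, add_mul]

theorem positionOp_smul (c : ℂ) (u : X →ᵇ ℂ) : positionOp (c • u) = c • positionOp u := by
  ext1 f
  apply Lp.ext
  filter_upwards [coeFn_positionOp (c • u) f, coeFn_positionOp u f,
    Lp.coeFn_smul c (positionOp u f)] with x h₁ h₂ h₃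
  rw [_root_.smul_apply, h₃, Pi.smul_apply, h₁, h₂, BoundedContinuousFunction.smul_apply,
    smul_eq_mul, smul_eq_mul, mul_assoc]

theorem positionOp_mul (u w : X →ᵇ ℂ) : positionOp (u * w) = positionOp u ∘L positionOp w := by
  ext1 f
  apply Lp.ext
  filter_upwards [coeFn_positionOp (u * w) f, coeFn_positionOp w f,
    coeFn_positionOp u (positionOp w f)] with x h₁ h₂ h₃
  rw [ContinuousLinearMap.comp_apply, h₃, h₁, h₂, mul_apply, mul_assoc]

theorem norm_positionOp_le (u : X →ᵇ ℂ) : ‖positionOp u‖ ≤ ‖u‖ :=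
  LinearMap.mkContinuous_norm_le _ (norm_nonneg _) _

variable (X) in
/-- The representation of the bounded continuous functions by multiplication operators. -/
def positionMap : (X →ᵇ ℂ) →L[ℂ] (L2 X →L[ℂ] L2 X) :=
  LinearMap.mkContinuous
    { toFun := positionOp
      map_add' := positionOp_add
      map_smul' := positionOp_smul } 1
    (fun u => by simpa using norm_positionOp_le u)

theorem coeFn_translationOp (x : X) (f : L2 X) :
    translationOp x f =ᵐ[volume] fun y => f (y - x) :=
  Lp.coeFn_compMeasurePreserving f (measurePreserving_sub_right volume x)

theorem norm_translationOp_apply (x : X) (f : L2 X) : ‖translationOp x f‖ = ‖f‖ :=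
  Lp.norm_compMeasurePreserving f (measurePreserving_sub_right volume x)

theorem translationOp_translationOp_neg (x : X) (f : L2 X) :
    translationOp x (translationOp (-x) f) = f := by
  apply Lp.ext
  filter_upwards [coeFn_translationOp x (translationOp (-x) f),
    (measurePreserving_sub_right volume x).quasiMeasurePreserving.ae
      (coeFn_translationOp (-x) f)] with y h₁ h₂
  rw [h₁, h₂]
  simp

theorem adjoint_translationOp (x : X) :
    ContinuousLinearMap.adjoint (translationOp x) = translationOp (-x) := by
  have h : ContinuousLinearMap.adjoint (translationOp x) ∘L translationOp x = 1 :=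
    (ContinuousLinearMap.norm_map_iff_adjoint_comp_self _).1 (norm_translationOp_apply x)
  ext1 f
  have := DFunLike.congr_fun h (translationOp (-x) f)
  simpa [translationOp_translationOp_neg] using this

theorem translationOp_positionOp (x : X) (u : X →ᵇ ℂ) (f : L2 X) :
    translationOp (-x) (positionOp u f) =
      positionOp (translate x u) (translationOp (-x) f) := by
  apply Lp.ext
  filter_upwards [coeFn_translationOp (-x) (positionOp u f),
    coeFn_positionOp (translate x u) (translationOp (-x) f), coeFn_translationOp (-x) f,
    (measurePreserving_sub_right volume (-x)).quasiMeasurePreserving.ae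
      (coeFn_positionOp u f)] with y h₁ h₂ h₃ h₄
  rw [h₁, h₂, h₃, h₄, translate_apply, sub_neg_eq_add]

/-- The character `y ↦ exp (-2πi⟨x, y⟩)`. -/
def character (x : X) : X →ᵇ ℂ :=
  ofNormedAddCommGroup (fun y => (Real.fourierChar (innerₗ X (-x) y) : ℂ))
    (by
      simp only [innerₗ_apply_apply]
      exact continuous_subtype_val.comp (Real.continuous_fourierChar.comp (by fun_prop))) 1
    (fun y => (Circle.norm_coe _).le)

/-- Both sides are continuous in `f`, so Schwartz functions suffice; there it is a change of
variable in the Fourier integral. -/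
theorem fourier_translationOp (x : X) (f : L2 X) :
    Lp.fourierTransformₗᵢ X ℂ (translationOp x f) =
      positionOp (character x) (Lp.fourierTransformₗᵢ X ℂ f) := by
  refine DenseRange.induction_on
    (p := fun f : L2 X => Lp.fourierTransformₗᵢ X ℂ (translationOp x f) =
      positionOp (character x) (Lp.fourierTransformₗᵢ X ℂ f))
    (SchwartzMap.denseRange_toLpCLM (E := X) (F := ℂ) (p := 2)
      ENNReal.ofNat_ne_top) f ?_ fun g => ?_
  · exact isClosed_eq (by fun_prop) (by fun_prop)
  have hT : translationOp x (g.toLp 2) = (g.compSubConstCLM ℂ x).toLp 2 := by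
    apply Lp.ext
    filter_upwards [coeFn_translationOp x (g.toLp 2),
      (measurePreserving_sub_right volume x).quasiMeasurePreserving.ae
        (g.coeFn_toLp 2 volume), (g.compSubConstCLM ℂ x).coeFn_toLp 2 volume] with y h₁ h₂ h₃
    rw [h₁, h₂, h₃, SchwartzMap.compSubConstCLM_apply]
  have hF (h : SchwartzMap X ℂ) : Lp.fourierTransformₗᵢ X ℂ (h.toLp 2) = (𝓕 h).toLp 2 :=
    SchwartzMap.toLp_fourier_eq h
  rw [SchwartzMap.toLpCLM_apply, hT, hF, hF]
  apply Lp.ext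
  filter_upwards [(𝓕 (g.compSubConstCLM ℂ x)).coeFn_toLp 2 volume,
    coeFn_positionOp (character x) ((𝓕 g).toLp 2), (𝓕 g).coeFn_toLp 2 volume] with y h₁ h₂ h₃
  rw [h₁, h₂, h₃, SchwartzMap.fourier_coe, SchwartzMap.fourier_coe]
  have hc : ⇑(g.compSubConstCLM ℂ x) = g ∘ fun z => z + -x := by
    ext z
    rw [SchwartzMap.compSubConstCLM_apply, Function.comp_apply, sub_eq_add_neg]
  rw [hc]
  exact congr_fun (VectorFourier.fourierIntegral_comp_add_right Real.fourierChar
    (volume : Measure X) (innerₗ X) g (-x)) y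

/-- On the Fourier side both operators are multiplications, which commute. -/
theorem momentumOp_translationOp (v : C₀(X, ℂ)) (x : X) (f : L2 X) :
    momentumOp v (translationOp x f) = translationOp x (momentumOp v f) := by
  have hF (g : L2 X) :
      Lp.fourierTransformₗᵢ X ℂ (momentumOp v g) =
        positionOp v.toBCF (Lp.fourierTransformₗᵢ X ℂ g) :=
    (Lp.fourierTransformₗᵢ X ℂ).apply_symm_apply _
  apply (Lp.fourierTransformₗᵢ X ℂ).injective
  rw [hF, fourier_translationOp, fourier_translationOp, hF, ← ContinuousLinearMap.comp_apply,
    ← ContinuousLinearMap.comp_apply, ← positionOp_mul, ← positionOp_mul, mul_comm]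

theorem conj_translationOp (x : X) (u : X →ᵇ ℂ) (v : C₀(X, ℂ)) :
    ContinuousLinearMap.adjoint (translationOp x) ∘L (positionOp u ∘L momentumOp v) ∘L
        translationOp x = positionOp (translate x u) ∘L momentumOp v := by
  ext1 f
  simp only [ContinuousLinearMap.comp_apply]
  rw [adjoint_translationOp, translationOp_positionOp, momentumOp_translationOp]
  exact congrArg _ (by simpa using translationOp_translationOp_neg (-x) (momentumOp v f))

/-- Bounded pointwise convergence of functions implies strong convergence of the
multiplication operators. -/
theorem tendsto_positionOp {ι : Type*} {l : Filter ι} [l.IsCountablyGenerated]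
    {u : ι → X →ᵇ ℂ} {w : X →ᵇ ℂ} {M : ℝ} (hM : ∀ i, ‖u i‖ ≤ M)
    (h : ∀ x, Tendsto (fun i => u i x) l (𝓝 (w x))) (f : L2 X) :
    Tendsto (fun i => positionOp (u i) f) l (𝓝 (positionOp w f)) := by
  have hsq (g : L2 X) : ‖g‖ ^ 2 = ∫ x, ‖g x‖ ^ 2 := by
    have := L2.inner_def (𝕜 := ℂ) g g
    rw [inner_self_eq_norm_sq_to_K] at this
    apply Complex.ofReal_injective
    refine Eq.trans ?_ (integral_complex_ofReal (f := fun x => ‖g x‖ ^ 2))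
    simpa [inner_self_eq_norm_sq_to_K] using this
  rw [tendsto_iff_norm_sub_tendsto_zero]
  have key : Tendsto (fun i => ‖positionOp (u i) f - positionOp w f‖ ^ 2) l (𝓝 0) := by
    have heq (i : ι) : ‖positionOp (u i) f - positionOp w f‖ ^ 2 =
        ∫ x, ‖u i x - w x‖ ^ 2 * ‖f x‖ ^ 2 := by
      rw [hsq]
      apply integral_congr_ae
      filter_upwards [Lp.coeFn_sub (positionOp (u i) f) (positionOp w f),
        coeFn_positionOp (u i) f, coeFn_positionOp w f] with x h₁ h₂ h₃
      rw [h₁, Pi.sub_apply, h₂, h₃, ← sub_mul, norm_mul, mul_pow]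
    simp only [heq]
    have hf : Integrable (fun x => ‖f x‖ ^ 2) := (Lp.memLp f).integrable_norm_pow two_ne_zero
    have := tendsto_integral_filter_of_dominated_convergence (μ := (volume : Measure X)) (l := l)
      (F := fun i x => ‖u i x - w x‖ ^ 2 * ‖f x‖ ^ 2) (f := fun _ => (0 : ℝ))
      (fun x => (M + ‖w‖) ^ 2 * ‖f x‖ ^ 2)
      (Eventually.of_forall fun i =>
        ((u i - w).continuous.norm.pow 2).aestronglyMeasurable.mul hf.aestronglyMeasurable)
      (Eventually.of_forall fun i => Eventually.of_forall fun x => by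
        rw [Real.norm_of_nonneg (by positivity)]
        gcongr
        exact (norm_sub_le _ _).trans
          (add_le_add (((u i).norm_coe_le_norm x).trans (hM i)) (w.norm_coe_le_norm x)))
      (hf.const_mul _)
      (Eventually.of_forall fun x => by
        have := (((h x).sub_const (w x)).norm.pow 2).mul_const (‖f x‖ ^ 2)
        simpa using this)
    simpa using this
  simpa using key.sqrt

theorem positionOp_apply_eq_zero {u : X →ᵇ ℂ} (hu : ∀ x, u x ≠ 0) {f : L2 X}
    (hf : positionOp u f = 0) : f = 0 := by
  apply Lp.ext
  filter_upwards [coeFn_positionOp u f, Lp.coeFn_zero ℂ 2 (volume : Measure X)] with x h₁ h₂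
  rw [hf, h₂] at h₁
  rw [h₂]
  exact (mul_eq_zero.1 h₁.symm).resolve_left (hu x)

/-- Testing on indicators of sets of finite measure gives `u = 0` almost everywhere; continuity
upgrades this to everywhere. -/
theorem eq_zero_of_positionOp_eq_zero {u : X →ᵇ ℂ} (hu : positionOp u = 0) : u = 0 := by
  have key : (u : X → ℂ) =ᵐ[volume] fun _ => 0 := by
    refine ae_of_forall_measure_lt_top_ae_restrict _ fun s hs hμ => ?_
    have h₁ := coeFn_positionOp u (indicatorConstLp 2 hs hμ.ne (1 : ℂ))
    rw [ae_restrict_iff' hs]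
    filter_upwards [h₁, Lp.coeFn_zero ℂ 2 (volume : Measure X),
      indicatorConstLp_coeFn (p := 2) (hs := hs) (hμs := hμ.ne) (c := (1 : ℂ))] with x h₁ h₂ h₃ hx
    rw [h₃, hu, zero_apply, h₂] at h₁
    simpa [hx] using h₁.symm
  ext x
  exact congr_fun ((u.continuous.ae_eq_iff_eq volume continuous_const).1 key) x

theorem momentumOp_ne_zero {v : C₀(X, ℂ)} (hv : v ≠ 0) : momentumOp v ≠ 0 := by
  intro h
  refine hv (ZeroAtInftyContinuousMap.toBCF_injective X ℂ
    (eq_zero_of_positionOp_eq_zero (ContinuousLinearMap.ext fun f => ?_)))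
  have := DFunLike.congr_fun h ((Lp.fourierTransformₗᵢ X ℂ).symm f)
  have h₂ : (Lp.fourierTransformₗᵢ X ℂ).symm (positionOp v.toBCF
      (Lp.fourierTransformₗᵢ X ℂ ((Lp.fourierTransformₗᵢ X ℂ).symm f))) = 0 := this
  simpa using h₂

end Operators

/-! ### Total boundedness of families of limits. -/

section Abstract

variable {F G : Type*} [UniformSpace F] [CompleteSpace F] [UniformSpace G]

/-- Completeness makes the closures compact, so no uniform continuity is needed; multiplication is
not uniformly continuous. -/
theorem totallyBounded_image2 {F' : Type*} [UniformSpace F'] [CompleteSpace F']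
    {f : F → F' → G} (hf : Continuous fun p : F × F' => f p.1 p.2) {s : Set F} {t : Set F'}
    (hs : TotallyBounded s) (ht : TotallyBounded t) : TotallyBounded (Set.image2 f s t) := by
  have hK := ((hs.closure.isCompact_of_isClosed isClosed_closure).prod
    (ht.closure.isCompact_of_isClosed isClosed_closure)).image hf
  refine hK.totallyBounded.subset ?_
  rintro _ ⟨x, hx, y, hy, rfl⟩
  exact ⟨(x, y), ⟨subset_closure hx, subset_closure hy⟩, rfl⟩

theorem totallyBounded_image {f : F → G} (hf : Continuous f) {s : Set F}
    (hs : TotallyBounded s) : TotallyBounded (f '' s) :=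
  (((hs.closure.isCompact_of_isClosed isClosed_closure).image hf).totallyBounded).subset
    (Set.image_mono subset_closure)

/-- `u` has an `R i`-limit for every `i`, and these limits form a totally bounded set. -/
def HasTotallyBoundedLimits {I : Type*} (R : I → F → F → Prop) (u : F) : Prop :=
  ∃ τ : I → F, (∀ i, R i u (τ i)) ∧ TotallyBounded (Set.range τ)

/-- If the relations `R i` are contractive with closed graph, then having a totally bounded family
of `R i`-limits is a closed condition. -/
theorem HasTotallyBoundedLimits.of_mem_closure {I F : Type*} [PseudoMetricSpace F]
    [CompleteSpace F] {R : I → F → F → Prop}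
    (hR : ∀ i u b u' b', R i u b → R i u' b' → dist b b' ≤ dist u u')
    (hc : ∀ i, IsClosed {p : F × F | R i p.1 p.2}) {u : F}
    (hu : u ∈ closure {u | HasTotallyBoundedLimits R u}) : HasTotallyBoundedLimits R u := by
  obtain ⟨w, hw, hlim⟩ := mem_closure_iff_seq_limit.1 hu
  choose τ hτ htb using hw
  have hcau (i : I) : CauchySeq fun n => τ n i := by
    rw [Metric.cauchySeq_iff]
    intro ε hε
    obtain ⟨N, hN⟩ := Metric.cauchySeq_iff.1 hlim.cauchySeq ε hε
    exact ⟨N, fun m hm n hn =>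
      (hR i _ _ _ _ (hτ m i) (hτ n i)).trans_lt (hN m hm n hn)⟩
  choose σ hσ using fun i => cauchySeq_tendsto_of_complete (hcau i)
  have hmem (i : I) : R i u (σ i) :=
    (hc i).mem_of_tendsto (hlim.prodMk_nhds (hσ i)) (Eventually.of_forall fun n => hτ n i)
  refine ⟨σ, hmem, ?_⟩
  rw [Metric.totallyBounded_iff]
  intro ε hε
  -- By contractivity one `n` serves all `i` at once, so an `ε / 2`-net for the limits of `w n` is
  -- an `ε`-net for those of `u`.
  obtain ⟨n, hn⟩ := (Metric.tendsto_nhds.1 hlim (ε / 2) (half_pos hε)).exists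
  obtain ⟨t, ht, hcov⟩ := Metric.totallyBounded_iff.1 (htb n) (ε / 2) (half_pos hε)
  refine ⟨t, ht, ?_⟩
  rintro _ ⟨i, rfl⟩
  obtain ⟨y, hy, hyi⟩ := Set.mem_iUnion₂.1 (hcov ⟨i, rfl⟩)
  refine Set.mem_iUnion₂.2 ⟨y, hy, ?_⟩
  rw [Metric.mem_ball] at hyi ⊢
  have h := hR i _ _ _ _ (hmem i) (hτ n i)
  rw [dist_comm u] at h
  linarith [dist_triangle (σ i) (τ n i) y]

end Abstract

/-! ### Limits along rays. -/

section Directions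

variable {E : Type*} [SeminormedAddCommGroup E] [NormedSpace ℝ E]

/-- Rescaling `r` shows that one generator of the half-line decides the limit for all. -/
theorem tendsto_of_mem_halfLine {β : Type*} {F : E → β} {l : Filter β} {a b : E}
    (ha : a ∈ halfLine b) (h : Tendsto (fun r : ℝ => F (r • b)) atTop l) :
    Tendsto (fun r : ℝ => F (r • a)) atTop l := by
  obtain ⟨s, hs, rfl⟩ := ha
  simpa only [Function.comp_def, smul_smul, id] using h.comp (tendsto_id.atTop_mul_const hs)

theorem mem_halfLine_self (a : E) : a ∈ halfLine a := ⟨1, one_pos, (one_smul ℝ a).symm⟩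

theorem mem_halfLine_symm {a b : E} (h : a ∈ halfLine b) : b ∈ halfLine a := by
  obtain ⟨s, hs, rfl⟩ := h
  exact ⟨s⁻¹, inv_pos.2 hs, by rw [smul_smul, inv_mul_cancel₀ hs.ne', one_smul]⟩

/-- The half-line generated by a nonzero vector, as a point at infinity. -/
def direction (a : E) (ha : a ≠ 0) : SphereAtInfinity E := ⟨halfLine a, a, ha, rfl⟩

/-- A spherical limit is also the limit along every translated ray in its direction. -/
theorem HasSphericalLimit.tendsto {u : E → ℂ} {a : E} {α : SphereAtInfinity E} {c : ℂ}
    (hα : α.1 = halfLine a) (h : HasSphericalLimit u α c) (ha : ‖a‖ ≠ 0) (x : E) :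
    Tendsto (fun r : ℝ => u (x + r • a)) atTop (𝓝 c) := by
  intro V hV
  obtain ⟨_, hCo, ⟨K, B, hK, hB, rfl⟩, ⟨b, hbα, hb⟩, hCV⟩ := h V hV
  have hab : a ∈ halfLine b := mem_halfLine_symm (hα ▸ hbα)
  have hbn : ‖b‖ ≠ 0 := by
    obtain ⟨s, hs, rfl⟩ := hab
    rw [norm_smul] at ha
    exact right_ne_zero_of_mul ha
  have hbC : b ∈ K \ B := by simpa using hb 1 le_rfl
  obtain ⟨M, hM⟩ := hB.exists_norm_le
  suffices h : Tendsto (fun r : ℝ => x + r • b) atTop (𝓟 (K \ B)) by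
    have h' := tendsto_principal.1 (tendsto_of_mem_halfLine (F := fun y => x + y) hab h)
    exact h'.mono fun r hr => hCV _ hr
  rw [tendsto_principal]
  -- Write `x + r b = r (b + r⁻¹ x)`: openness at `b` and the cone property put it in `K`, and its
  -- norm eventually exceeds the bound on `B`.
  have hlim : Tendsto (fun r : ℝ => b + r⁻¹ • x) atTop (𝓝 b) := by
    have := (tendsto_inv_atTop_zero (𝕜 := ℝ)).smul_const x |>.const_add b
    rwa [zero_smul, add_zero] at this
  filter_upwards [hlim (hCo.mem_nhds hbC), eventually_gt_atTop 0,
    eventually_gt_atTop ((M + ‖x‖) / ‖b‖)] with r hr hr0 hrM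
  constructor
  · have := hK _ hr.1 r hr0
    rwa [smul_add, smul_smul, mul_inv_cancel₀ hr0.ne', one_smul, add_comm] at this
  · intro hmem
    have h₁ := hM _ hmem
    have h₂ : ‖r • b‖ ≤ ‖x + r • b‖ + ‖x‖ := by
      simpa using norm_sub_le (x + r • b) x
    rw [norm_smul, Real.norm_of_nonneg hr0.le] at h₂
    rw [div_lt_iff₀ (lt_of_le_of_ne (norm_nonneg b) hbn.symm)] at hrM
    linarith

theorem norm_mkQ_le (Y : Submodule ℝ E) (x : E) : ‖Y.mkQ x‖ ≤ ‖x‖ :=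
  Submodule.Quotient.norm_mk_le Y x

end Directions

/-! ### Limits of elementary interactions along rays. -/

section Algebra

variable {E : Type*} [NormedAddCommGroup E] [NormedSpace ℝ E]

/-- Finite dimension makes `Y` closed, so the quotient seminorm is definite. -/
theorem norm_mkQ_eq_zero [FiniteDimensional ℝ E] {Y : Submodule ℝ E} {a : E} :
    ‖Y.mkQ a‖ = 0 ↔ a ∈ Y := by
  refine (QuotientAddGroup.norm_mk_eq_zero_iff_mem_closure (S := Y.toAddSubgroup)).trans ?_
  rw [show closure ((Y.toAddSubgroup : Set E)) = Y from Y.closed_of_finiteDimensional.closure_eq,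
    SetLike.mem_coe]

/-- `w` is an elementary interaction and the pointwise limit of `x ↦ u (x + r a)` as `r → ∞`,
for every `a ∈ α`. -/
def IsInteractionLimit (α : SphereAtInfinity E) (u w : E →ᵇ ℂ) : Prop :=
  w ∈ interactionAlgebra E ∧
    ∀ a ∈ α.1, ∀ x, Tendsto (fun r : ℝ => u (x + r • a)) atTop (𝓝 (w x))

theorem norm_le_of_tendsto_rays {u w : E →ᵇ ℂ} {a : E}
    (h : ∀ x, Tendsto (fun r : ℝ => u (x + r • a)) atTop (𝓝 (w x))) : ‖w‖ ≤ ‖u‖ :=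
  (norm_le (norm_nonneg _)).2 fun x =>
    le_of_tendsto (h x).norm (Eventually.of_forall fun _ => u.norm_coe_le_norm _)

theorem IsInteractionLimit.dist_le (α : SphereAtInfinity E) (u w u' w' : E →ᵇ ℂ)
    (h : IsInteractionLimit α u w) (h' : IsInteractionLimit α u' w') :
    dist w w' ≤ dist u u' := by
  obtain ⟨a, -, hα⟩ := α.2
  have ha : a ∈ α.1 := hα ▸ mem_halfLine_self a
  rw [dist_eq_norm, dist_eq_norm]
  exact norm_le_of_tendsto_rays (a := a) fun x => (h.2 a ha x).sub (h'.2 a ha x)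

/-- The evaluations `u ↦ u (x + r • a)` are 1-Lipschitz, hence equicontinuous in `r`, so convergence
to a continuously varying value is a closed condition. -/
theorem isClosed_isInteractionLimit (α : SphereAtInfinity E) :
    IsClosed {p : (E →ᵇ ℂ) × (E →ᵇ ℂ) | IsInteractionLimit α p.1 p.2} := by
  suffices h : IsClosed {p : (E →ᵇ ℂ) × (E →ᵇ ℂ) | ∀ a ∈ α.1, ∀ x,
      Tendsto (fun r : ℝ => p.1 (x + r • a)) atTop (𝓝 (p.2 x))} from
    ((StarSubalgebra.isClosed_topologicalClosure _).preimage continuous_snd).inter h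
  simp only [Set.ofPred_forall]
  refine isClosed_iInter fun a => isClosed_iInter fun _ => isClosed_iInter fun x => ?_
  refine Equicontinuous.isClosed_setOfPred_tendsto ?_ ?_
  · refine (LipschitzWith.uniformEquicontinuous _ 1 fun r => ?_).equicontinuous
    refine LipschitzWith.of_dist_le_mul fun p q => ?_
    rw [NNReal.coe_one, one_mul]
    exact (dist_coe_le_dist _).trans (le_max_left _ _)
  · exact (continuous_eval_const (F := E →ᵇ ℂ) x).comp continuous_snd

theorem quotientFunctions_subset_interactionAlgebra (Y : Submodule ℝ E) :
    quotientFunctions Y ⊆ interactionAlgebra E := fun _ hu =>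
  StarSubalgebra.le_topologicalClosure _
    (StarAlgebra.subset_adjoin ℂ _ (Set.mem_iUnion.2 ⟨Y, hu⟩))

theorem tendsto_of_mem_quotientFunctions [FiniteDimensional ℝ E] {Y : Submodule ℝ E} {a : E}
    (ha : a ∉ Y) {u : E →ᵇ ℂ} (hu : u ∈ quotientFunctions Y) :
    ∃ c : ℂ, ∀ x, Tendsto (fun r : ℝ => u (x + r • a)) atTop (𝓝 c) := by
  obtain ⟨v, ⟨-, hv⟩, huv⟩ := hu
  have ha' : ‖Y.mkQ a‖ ≠ 0 := fun h => ha (norm_mkQ_eq_zero.1 h)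
  obtain ⟨c, hc⟩ := hv (direction (Y.mkQ a) fun h => ha' (by rw [h, norm_zero]))
  refine ⟨c, fun x => ?_⟩
  simpa only [huv, map_add, map_smul] using hc.tendsto rfl ha' (Y.mkQ x)

theorem apply_add_smul_of_mem_quotientFunctions {Y : Submodule ℝ E} {a : E}
    (ha : a ∈ Y) {u : E →ᵇ ℂ} (hu : u ∈ quotientFunctions Y) (x : E) (r : ℝ) :
    u (x + r • a) = u x := by
  obtain ⟨v, -, huv⟩ := hu
  rw [huv, huv, map_add, map_smul, show Y.mkQ a = 0 by simpa using ha, smul_zero, add_zero]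

theorem hasTotallyBoundedLimits_of_mem_quotientFunctions [FiniteDimensional ℝ E]
    {Y : Submodule ℝ E} {u : E →ᵇ ℂ} (hu : u ∈ quotientFunctions Y) :
    HasTotallyBoundedLimits IsInteractionLimit u := by
  have key (α : SphereAtInfinity E) :
      ∃ w, IsInteractionLimit α u w ∧
        w ∈ insert u (algebraMap ℂ (E →ᵇ ℂ) '' Metric.closedBall 0 ‖u‖) := by
    obtain ⟨_, a, -, rfl⟩ := α
    by_cases ha : a ∈ Y
    · refine ⟨u, ⟨quotientFunctions_subset_interactionAlgebra Y hu, fun b hb x => ?_⟩,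
        Set.mem_insert _ _⟩
      refine tendsto_of_mem_halfLine (F := fun y => u (x + y)) hb ?_
      simp only [apply_add_smul_of_mem_quotientFunctions ha hu, tendsto_const_nhds]
    · obtain ⟨c, hc⟩ := tendsto_of_mem_quotientFunctions ha hu
      refine ⟨algebraMap ℂ _ c, ⟨algebraMap_mem _ c, fun b hb x =>
        tendsto_of_mem_halfLine (F := fun y => u (x + y)) hb (hc x)⟩,
        Set.mem_insert_of_mem _ ⟨c, ?_, rfl⟩⟩
      rw [mem_closedBall_zero_iff]
      exact le_of_tendsto (hc 0).norm (Eventually.of_forall fun _ => u.norm_coe_le_norm _)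
  choose τ hτ hmem using key
  refine ⟨τ, hτ, TotallyBounded.subset (Set.range_subset_iff.2 hmem) ?_⟩
  exact (((isCompact_closedBall _ _).image
    (algebraMapCLM ℂ (E →ᵇ ℂ)).continuous).insert u).totallyBounded

theorem hasTotallyBoundedLimits_of_mem_interactionAlgebra [FiniteDimensional ℝ E]
    {u : E →ᵇ ℂ} (hu : u ∈ interactionAlgebra E) :
    HasTotallyBoundedLimits IsInteractionLimit u := by
  refine HasTotallyBoundedLimits.of_mem_closure IsInteractionLimit.dist_le
    isClosed_isInteractionLimit (closure_mono (fun w hw => ?_) hu)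
  replace hw : w ∈ StarAlgebra.adjoin ℂ (⋃ Y : Submodule ℝ E, quotientFunctions Y) := hw
  induction hw using StarAlgebra.adjoin_induction with
  | mem w hw =>
    obtain ⟨Y, hY⟩ := Set.mem_iUnion.1 hw
    exact hasTotallyBoundedLimits_of_mem_quotientFunctions hY
  | algebraMap c =>
    refine ⟨fun _ => algebraMap ℂ _ c, fun α => ⟨algebraMap_mem _ c, fun a _ x => ?_⟩, ?_⟩
    · exact tendsto_const_nhds
    · exact (Set.finite_range_const).totallyBounded
  | add w w' _ _ h h' =>
    obtain ⟨τ, hτ, htb⟩ := h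
    obtain ⟨τ', hτ', htb'⟩ := h'
    refine ⟨fun α => τ α + τ' α, fun α => ⟨add_mem (hτ α).1 (hτ' α).1, fun a ha x =>
      ((hτ α).2 a ha x).add ((hτ' α).2 a ha x)⟩, ?_⟩
    refine (totallyBounded_image2 continuous_add htb htb').subset ?_
    rintro _ ⟨α, rfl⟩
    exact ⟨_, ⟨α, rfl⟩, _, ⟨α, rfl⟩, rfl⟩
  | mul w w' _ _ h h' =>
    obtain ⟨τ, hτ, htb⟩ := h
    obtain ⟨τ', hτ', htb'⟩ := h'
    refine ⟨fun α => τ α * τ' α, fun α => ⟨mul_mem (hτ α).1 (hτ' α).1, fun a ha x =>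
      ((hτ α).2 a ha x).mul ((hτ' α).2 a ha x)⟩, ?_⟩
    refine (totallyBounded_image2 continuous_mul htb htb').subset ?_
    rintro _ ⟨α, rfl⟩
    exact ⟨_, ⟨α, rfl⟩, _, ⟨α, rfl⟩, rfl⟩
  | star w _ h =>
    obtain ⟨τ, hτ, htb⟩ := h
    refine ⟨fun α => star (τ α), fun α => ⟨star_mem (hτ α).1, fun a ha x =>
      ((hτ α).2 a ha x).star⟩, ?_⟩
    refine (totallyBounded_image continuous_star htb).subset ?_
    rintro _ ⟨α, rfl⟩
    exact ⟨_, ⟨α, rfl⟩, rfl⟩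

end Algebra

/-! ### Translations at infinity of Hamiltonians, and relative compactness. -/

section Hamiltonian

variable {X : Type*} [NormedAddCommGroup X] [InnerProductSpace ℝ X] [FiniteDimensional ℝ X]
  [MeasurableSpace X] [BorelSpace X]

theorem isTranslationAtInfinity_of_tendsto {α : SphereAtInfinity X} {u w : X →ᵇ ℂ}
    (h : ∀ a ∈ α.1, ∀ x, Tendsto (fun r : ℝ => u (x + r • a)) atTop (𝓝 (w x))) (v : C₀(X, ℂ)) :
    IsTranslationAtInfinity α (positionOp u ∘L momentumOp v) (positionOp w ∘L momentumOp v) := by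
  intro a ha f
  simp only [conj_translationOp]
  exact tendsto_positionOp (fun r => norm_translate_le (r • a) u) (h a ha) (momentumOp v f)

theorem IsTranslationAtInfinity.add {α : SphereAtInfinity X} {A B A' B' : L2 X →L[ℂ] L2 X}
    (h : IsTranslationAtInfinity α A B) (h' : IsTranslationAtInfinity α A' B') :
    IsTranslationAtInfinity α (A + A') (B + B') := by
  intro a ha f
  simpa using (h a ha f).add (h' a ha f)

theorem IsTranslationAtInfinity.smul {α : SphereAtInfinity X} {A B : L2 X →L[ℂ] L2 X}
    (h : IsTranslationAtInfinity α A B) (c : ℂ) :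
    IsTranslationAtInfinity α (c • A) (c • B) := by
  intro a ha f
  simpa using (h a ha f).const_smul c

theorem norm_conj_translationOp_apply_le (x : X) (A : L2 X →L[ℂ] L2 X) (f : L2 X) :
    ‖(ContinuousLinearMap.adjoint (translationOp x) ∘L A ∘L translationOp x) f‖ ≤
      ‖A‖ * ‖f‖ := by
  rw [adjoint_translationOp, ContinuousLinearMap.comp_apply, norm_translationOp_apply,
    ContinuousLinearMap.comp_apply, ← norm_translationOp_apply x f]
  exact A.le_opNorm _

theorem IsTranslationAtInfinity.dist_le (α : SphereAtInfinity X) (A B A' B' : L2 X →L[ℂ] L2 X)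
    (h : IsTranslationAtInfinity α A B) (h' : IsTranslationAtInfinity α A' B') :
    dist B B' ≤ dist A A' := by
  obtain ⟨a, -, hα⟩ := α.2
  have ha : a ∈ α.1 := hα ▸ mem_halfLine_self a
  rw [dist_eq_norm, dist_eq_norm]
  refine ContinuousLinearMap.opNorm_le_bound _ (norm_nonneg _) fun f => ?_
  refine le_of_tendsto ((h a ha f).sub (h' a ha f)).norm (Eventually.of_forall fun r => ?_)
  simpa using norm_conj_translationOp_apply_le (r • a) (A - A') f

theorem IsTranslationAtInfinity.unique {α : SphereAtInfinity X} {A B B' : L2 X →L[ℂ] L2 X}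
    (h : IsTranslationAtInfinity α A B) (h' : IsTranslationAtInfinity α A B') : B = B' :=
  dist_le_zero.1 (by simpa using h.dist_le α A B A B' h')

/-- Uniqueness of the limit makes the choice in the definition immaterial. -/
theorem IsTranslationAtInfinity.translationAtInfinity_eq {α : SphereAtInfinity X}
    {A B : L2 X →L[ℂ] L2 X} (h : IsTranslationAtInfinity α A B) :
    translationAtInfinity α A = B := by
  have hex : ∃ B, IsTranslationAtInfinity α A B := ⟨B, h⟩
  rw [translationAtInfinity, dif_pos hex]
  exact hex.choose_spec.unique h

/-- `B` is the translation at infinity of `A` along `α`, and lies in the Hamiltonian algebra. -/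
def IsHamiltonianLimit (α : SphereAtInfinity X) (A B : L2 X →L[ℂ] L2 X) : Prop :=
  B ∈ hamiltonianAlgebra X ∧ IsTranslationAtInfinity α A B

theorem isClosed_isHamiltonianLimit (α : SphereAtInfinity X) :
    IsClosed {p : (L2 X →L[ℂ] L2 X) × (L2 X →L[ℂ] L2 X) | IsHamiltonianLimit α p.1 p.2} := by
  suffices h : IsClosed {p : (L2 X →L[ℂ] L2 X) × (L2 X →L[ℂ] L2 X) |
      IsTranslationAtInfinity α p.1 p.2} from
    ((Submodule.isClosed_topologicalClosure _).preimage continuous_snd).inter h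
  simp only [IsTranslationAtInfinity, Set.ofPred_forall]
  refine isClosed_iInter fun a => isClosed_iInter fun _ => isClosed_iInter fun f => ?_
  refine Equicontinuous.isClosed_setOfPred_tendsto ?_ ?_
  · refine (LipschitzWith.uniformEquicontinuous _ ‖f‖₊ fun r => ?_).equicontinuous
    refine LipschitzWith.of_dist_le_mul fun p q => ?_
    rw [dist_eq_norm, coe_nnnorm, mul_comm]
    refine le_trans ?_ (mul_le_mul_of_nonneg_right
      ((dist_eq_norm p.1 q.1).symm.le.trans (le_max_left _ (dist p.2 q.2))) (norm_nonneg f))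
    simpa using norm_conj_translationOp_apply_le (r • a) (p.1 - q.1) f
  · exact ((ContinuousLinearMap.apply ℂ (L2 X) f).continuous).comp continuous_snd

theorem positionOp_comp_momentumOp_mem {u : X →ᵇ ℂ} (hu : u ∈ interactionAlgebra X)
    (v : C₀(X, ℂ)) : positionOp u ∘L momentumOp v ∈ hamiltonianAlgebra X :=
  Submodule.le_topologicalClosure _ (Submodule.subset_span ⟨u, hu, v, rfl⟩)

theorem hasTotallyBoundedLimits_of_mem_hamiltonianAlgebra {A : L2 X →L[ℂ] L2 X}
    (hA : A ∈ hamiltonianAlgebra X) : HasTotallyBoundedLimits IsHamiltonianLimit A := by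
  refine HasTotallyBoundedLimits.of_mem_closure
    (fun α A B A' B' h h' => h.2.dist_le α A B A' B' h'.2)
    isClosed_isHamiltonianLimit (closure_mono (fun B hB => ?_) hA)
  induction hB using Submodule.span_induction with
  | mem B hB =>
    obtain ⟨u, hu, v, rfl⟩ := hB
    obtain ⟨τ, hτ, htb⟩ := hasTotallyBoundedLimits_of_mem_interactionAlgebra hu
    refine ⟨fun α => positionOp (τ α) ∘L momentumOp v, fun α =>
      ⟨positionOp_comp_momentumOp_mem (hτ α).1 v,
        isTranslationAtInfinity_of_tendsto (hτ α).2 v⟩, ?_⟩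
    -- Norm continuity of `w ↦ w(q)v(p)` transfers total boundedness from functions to operators.
    have hc : Continuous fun w : X →ᵇ ℂ => positionMap X w ∘L momentumOp v := by fun_prop
    refine (totallyBounded_image hc htb).subset ?_
    rintro _ ⟨α, rfl⟩
    exact ⟨_, ⟨α, rfl⟩, rfl⟩
  | zero =>
    refine ⟨fun _ => 0, fun α => ⟨zero_mem _, fun a _ f => ?_⟩,
      Set.finite_range_const.totallyBounded⟩
    simp
  | add A A' _ _ h h' =>
    obtain ⟨τ, hτ, htb⟩ := h
    obtain ⟨τ', hτ', htb'⟩ := h'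
    refine ⟨fun α => τ α + τ' α, fun α =>
      ⟨add_mem (hτ α).1 (hτ' α).1, (hτ α).2.add (hτ' α).2⟩, ?_⟩
    refine (totallyBounded_image2 continuous_add htb htb').subset ?_
    rintro _ ⟨α, rfl⟩
    exact ⟨_, ⟨α, rfl⟩, _, ⟨α, rfl⟩, rfl⟩
  | smul c A _ h =>
    obtain ⟨τ, hτ, htb⟩ := h
    refine ⟨fun α => c • τ α, fun α =>
      ⟨Submodule.smul_mem _ c (hτ α).1, (hτ α).2.smul c⟩, ?_⟩
    refine (totallyBounded_image (continuous_const_smul c) htb).subset ?_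
    rintro _ ⟨α, rfl⟩
    exact ⟨_, ⟨α, rfl⟩, rfl⟩

theorem isHamiltonianLimit_translationAtInfinity {A : L2 X →L[ℂ] L2 X}
    (hA : A ∈ hamiltonianAlgebra X) (α : SphereAtInfinity X) :
    IsHamiltonianLimit α A (translationAtInfinity α A) := by
  obtain ⟨τ, hτ, -⟩ := hasTotallyBoundedLimits_of_mem_hamiltonianAlgebra hA
  rw [(hτ α).2.translationAtInfinity_eq]
  exact hτ α

theorem isCompact_closure_translationAtInfinity {A : L2 X →L[ℂ] L2 X}
    (hA : A ∈ hamiltonianAlgebra X) :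
    IsCompact (closure {B : hamiltonianAlgebra X |
      ∃ α : SphereAtInfinity X, (B : L2 X →L[ℂ] L2 X) = translationAtInfinity α A}) := by
  obtain ⟨τ, hτ, htb⟩ := hasTotallyBoundedLimits_of_mem_hamiltonianAlgebra hA
  have : CompleteSpace (hamiltonianAlgebra X) :=
    (Submodule.isClosed_topologicalClosure _).completeSpace_coe
  refine (TotallyBounded.closure ?_).isCompact_of_isClosed isClosed_closure
  refine (totallyBounded_preimage isUniformEmbedding_subtype_val.isUniformInducing htb).subset ?_
  rintro B ⟨α, hα⟩
  exact ⟨α, by rw [hα, (hτ α).2.translationAtInfinity_eq]⟩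

end Hamiltonian

/-! ### The two functions of the counterexample; seminorms allow application to quotients. -/

section Slope

variable {E F : Type*} [SeminormedAddCommGroup E] [NormedSpace ℝ E]
  [SeminormedAddCommGroup F] [NormedSpace ℝ F]

/-- The function `x ↦ ‖L x‖ / (1 + ‖x‖)`, whose limit in the direction `a` is `‖L a‖ / ‖a‖`. -/
def slope (L : E →L[ℝ] F) : E →ᵇ ℂ :=
  ofNormedAddCommGroup (fun x => ((‖L x‖ / (1 + ‖x‖) : ℝ) : ℂ))
    (Complex.continuous_ofReal.comp
      (L.continuous.norm.div (by fun_prop) fun x => by positivity)) ‖L‖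
    (fun x => by
      rw [Complex.norm_real, Real.norm_of_nonneg (by positivity), div_le_iff₀ (by positivity)]
      nlinarith [L.le_opNorm x, norm_nonneg L, norm_nonneg x])

theorem slope_apply (L : E →L[ℝ] F) (x : E) : slope L x = ((‖L x‖ / (1 + ‖x‖) : ℝ) : ℂ) := rfl

theorem hasSphericalLimit_slope (L : E →L[ℝ] F) {α : SphereAtInfinity E} {a : E}
    (hα : a ∈ α.1) (ha : ‖a‖ ≠ 0) :
    HasSphericalLimit (slope L) α ((‖L a‖ / ‖a‖ : ℝ) : ℂ) := by
  intro V hV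
  obtain ⟨ε, hε, hεV⟩ := Metric.mem_nhds_iff.1 hV
  have ha' : 0 < ‖a‖ := lt_of_le_of_ne (norm_nonneg a) ha.symm
  set c : ℝ := ‖L a‖ / ‖a‖ with hc
  have hc0 : 0 ≤ c := by positivity
  have hca : ‖L a‖ = c * ‖a‖ := by rw [hc, div_mul_cancel₀ _ ha]
  -- The error is `(‖L x‖ - c‖x‖ - c) / (1 + ‖x‖)`. The cone bounds `‖L x‖ - c‖x‖` by `ε / 2 * ‖x‖`,
  -- and removing the ball gives `c < ε / 2 * ‖x‖`.
  refine ⟨{x | |‖L x‖ - c * ‖x‖| < ε / 2 * ‖x‖} \ Metric.closedBall 0 (2 * c / ε), ?_,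
    ⟨_, _, fun x hx r hr => ?_, Metric.isBounded_closedBall, rfl⟩, ?_, ?_⟩
  · exact (isOpen_lt (by fun_prop) (by fun_prop)).sdiff Metric.isClosed_closedBall
  · change |‖L (r • x)‖ - c * ‖r • x‖| < ε / 2 * ‖r • x‖
    rw [map_smul, norm_smul, norm_smul, Real.norm_of_nonneg hr.le,
      show r * ‖L x‖ - c * (r * ‖x‖) = r * (‖L x‖ - c * ‖x‖) by ring, abs_mul, abs_of_pos hr,
      show ε / 2 * (r * ‖x‖) = r * (ε / 2 * ‖x‖) by ring]
    exact mul_lt_mul_of_pos_left hx hr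
  · have hs : 0 < (2 * c / ε + 1) / ‖a‖ := by positivity
    refine ⟨((2 * c / ε + 1) / ‖a‖) • a, ?_, fun r hr => ?_⟩
    · obtain ⟨b, -, hb⟩ := α.2
      rw [hb] at hα ⊢
      obtain ⟨s, hs', rfl⟩ := hα
      exact ⟨_, mul_pos hs hs', smul_smul _ _ _⟩
    · have hr0 : 0 < r := one_pos.trans_le hr
      have hn : ‖r • ((2 * c / ε + 1) / ‖a‖) • a‖ = r * (2 * c / ε + 1) := by
        rw [norm_smul, norm_smul, Real.norm_of_nonneg hr0.le, Real.norm_of_nonneg hs.le,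
          div_mul_cancel₀ _ ha]
      have hLn : ‖L (r • ((2 * c / ε + 1) / ‖a‖) • a)‖ = c * (r * (2 * c / ε + 1)) := by
        rw [map_smul, map_smul, norm_smul, norm_smul, Real.norm_of_nonneg hr0.le,
          Real.norm_of_nonneg hs.le, hca]
        field_simp
      have hpos : 0 < 2 * c / ε + 1 := by positivity
      refine ⟨?_, ?_⟩
      · change |_ - c * _| < ε / 2 * _
        rw [hn, hLn, sub_self, abs_zero]
        positivity
      · rw [mem_closedBall_zero_iff, hn, not_le]
        nlinarith
  · rintro x ⟨hx, hxR⟩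
    apply hεV
    change |‖L x‖ - c * ‖x‖| < ε / 2 * ‖x‖ at hx
    rw [mem_closedBall_zero_iff, not_le, div_lt_iff₀ hε] at hxR
    rw [Metric.mem_ball, slope_apply, Complex.dist_eq, ← Complex.ofReal_sub, Complex.norm_real,
      Real.norm_eq_abs]
    have h1 : 0 < 1 + ‖x‖ := by positivity
    rw [show ‖L x‖ / (1 + ‖x‖) - c = (‖L x‖ - c * ‖x‖ - c) / (1 + ‖x‖) by field_simp; ring,
      abs_div, abs_of_pos h1, div_lt_iff₀ h1]
    have := abs_sub (‖L x‖ - c * ‖x‖) c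
    rw [abs_of_nonneg hc0] at this
    nlinarith

theorem tendsto_slope (L : E →L[ℝ] F) {a : E} (ha : ‖a‖ ≠ 0) (x : E) :
    Tendsto (fun r : ℝ => slope L (x + r • a)) atTop (𝓝 ((‖L a‖ / ‖a‖ : ℝ) : ℂ)) :=
  (hasSphericalLimit_slope L (α := direction a fun h => ha (by rw [h, norm_zero]))
    (mem_halfLine_self a) ha).tendsto rfl ha x

theorem slope_mem_sphericalFunctions (L : E →L[ℝ] F) (hE : ∀ a : E, a ≠ 0 → ‖a‖ ≠ 0) :
    (slope L : E → ℂ) ∈ sphericalFunctions E := by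
  refine ⟨(slope L).continuous, fun α => ?_⟩
  obtain ⟨a, ha, hα⟩ := α.2
  exact ⟨_, hasSphericalLimit_slope L (hα ▸ mem_halfLine_self a) (hE a ha)⟩

theorem HasSphericalLimit.comp {u : E → ℂ} {α : SphereAtInfinity E} {c : ℂ}
    (h : HasSphericalLimit u α c) {g : ℂ → ℂ} (hg : Continuous g) :
    HasSphericalLimit (g ∘ u) α (g c) := fun V hV =>
  h (g ⁻¹' V) (hg.continuousAt hV)

theorem comp_mem_sphericalFunctions {u : E → ℂ} (hu : u ∈ sphericalFunctions E) {g : ℂ → ℂ}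
    (hg : Continuous g) : g ∘ u ∈ sphericalFunctions E :=
  ⟨hg.comp hu.1, fun α => (hu.2 α).imp' g fun _ hc => hc.comp hg⟩

/-- The continuous linear projection onto a quotient. -/
def projection (Y : Submodule ℝ E) : E →L[ℝ] E ⧸ Y :=
  Y.mkQ.mkContinuous 1 fun x => by simpa using norm_mkQ_le Y x

@[simp]
theorem projection_apply (Y : Submodule ℝ E) (x : E) : projection Y x = Y.mkQ x := rfl

/-- The function `x ↦ 1 / (1 + ‖π_Y x‖)`. -/
def decayAcross (Y : Submodule ℝ E) : E →ᵇ ℂ :=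
  (1 - slope (ContinuousLinearMap.id ℝ (E ⧸ Y))).compContinuous
    ⟨projection Y, (projection Y).continuous⟩

theorem decayAcross_apply (Y : Submodule ℝ E) (x : E) :
    decayAcross Y x = 1 - slope (ContinuousLinearMap.id ℝ (E ⧸ Y)) (Y.mkQ x) := rfl

/-- Makes multiplication by this function injective, so that the limits in directions of `Y` are
nonzero. -/
theorem decayAcross_ne_zero (Y : Submodule ℝ E) (x : E) : decayAcross Y x ≠ 0 := by
  rw [decayAcross_apply, slope_apply, ← Complex.ofReal_one, ← Complex.ofReal_sub,
    Complex.ofReal_ne_zero, sub_ne_zero]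
  apply ne_of_gt
  rw [div_lt_one (by positivity)]
  simp

end Slope

/-! ### Membership of these functions in the interaction algebra. -/

section Quotient

variable {E : Type*} [NormedAddCommGroup E] [NormedSpace ℝ E] [FiniteDimensional ℝ E]

theorem norm_quotient_ne_zero {Y : Submodule ℝ E} (z : E ⧸ Y) (hz : z ≠ 0) : ‖z‖ ≠ 0 := by
  obtain ⟨x, rfl⟩ := Y.mkQ_surjective z
  intro h
  exact hz (by simpa using norm_mkQ_eq_zero.1 h)

theorem decayAcross_mem_quotientFunctions (Y : Submodule ℝ E) :
    decayAcross Y ∈ quotientFunctions Y :=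
  ⟨_, comp_mem_sphericalFunctions
    (slope_mem_sphericalFunctions (ContinuousLinearMap.id ℝ (E ⧸ Y)) norm_quotient_ne_zero)
    (continuous_const.sub continuous_id : Continuous fun z : ℂ => 1 - z), fun _ => rfl⟩

theorem tendsto_decayAcross {Y : Submodule ℝ E} {a : E} (ha : a ∉ Y) (x : E) :
    Tendsto (fun r : ℝ => decayAcross Y (x + r • a)) atTop (𝓝 0) := by
  have ha' : ‖Y.mkQ a‖ ≠ 0 := fun h => ha (norm_mkQ_eq_zero.1 h)
  have hlim := tendsto_slope (ContinuousLinearMap.id ℝ (E ⧸ Y)) ha' (Y.mkQ x)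
  rw [ContinuousLinearMap.id_apply, div_self ha', Complex.ofReal_one] at hlim
  have := hlim.const_sub 1
  rw [sub_self] at this
  simpa only [decayAcross_apply, map_add, map_smul] using this

/-- Functions on the compactification of `E` enter the generating family through `E ⧸ ⊥`, whose norm
is that of `E`. -/
theorem slope_mem_quotientFunctions_bot (Y : Submodule ℝ E) :
    slope (projection Y) ∈ quotientFunctions (⊥ : Submodule ℝ E) := by
  have hbot (x : E) : ‖(⊥ : Submodule ℝ E).mkQ x‖ = ‖x‖ := by
    refine (QuotientAddGroup.norm_mk (S := (⊥ : Submodule ℝ E).toAddSubgroup) x).trans ?_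
    simp
  refine ⟨slope ((Submodule.factor (bot_le : ⊥ ≤ Y)).mkContinuous 1 fun z => ?_),
    slope_mem_sphericalFunctions _ norm_quotient_ne_zero, fun x => ?_⟩
  · obtain ⟨x, rfl⟩ := Submodule.mkQ_surjective _ z
    rw [one_mul, hbot]
    exact norm_mkQ_le Y x
  · rw [slope_apply, slope_apply, hbot]
    rfl

/-- The interaction `‖π_Y x‖ / (1 + ‖x‖) + 1 / (1 + ‖π_Y x‖)`. -/
def slopeAddDecay (Y : Submodule ℝ E) : E →ᵇ ℂ := slope (projection Y) + decayAcross Y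

theorem slopeAddDecay_mem (Y : Submodule ℝ E) : slopeAddDecay Y ∈ interactionAlgebra E :=
  add_mem (quotientFunctions_subset_interactionAlgebra _ (slope_mem_quotientFunctions_bot Y))
    (quotientFunctions_subset_interactionAlgebra _ (decayAcross_mem_quotientFunctions Y))

end Quotient

/-! ### A set of translations at infinity that is not closed. -/

section Counterexample

variable {X : Type*} [NormedAddCommGroup X] [InnerProductSpace ℝ X] [FiniteDimensional ℝ X]
  [MeasurableSpace X] [BorelSpace X]

/-- Along `Y` the slope term tends to `0`, while the decay term is invariant. -/
theorem translationAtInfinity_slopeAddDecay_of_mem {Y : Submodule ℝ X} {a : X} (ha : a ≠ 0)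
    (haY : a ∈ Y) (v : C₀(X, ℂ)) :
    translationAtInfinity (direction a ha) (positionOp (slopeAddDecay Y) ∘L momentumOp v) =
      positionOp (decayAcross Y) ∘L momentumOp v := by
  refine (isTranslationAtInfinity_of_tendsto (fun b hb x => ?_) v).translationAtInfinity_eq
  refine tendsto_of_mem_halfLine (F := fun y => slopeAddDecay Y (x + y)) hb ?_
  have h := tendsto_slope (projection Y) (norm_ne_zero_iff.2 ha) x
  rw [projection_apply, norm_mkQ_eq_zero.2 haY, zero_div, Complex.ofReal_zero] at h
  have h' := h.add_const (decayAcross Y x)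
  rw [zero_add] at h'
  refine h'.congr fun r => ?_
  rw [slopeAddDecay, BoundedContinuousFunction.add_apply,
    apply_add_smul_of_mem_quotientFunctions haY (decayAcross_mem_quotientFunctions Y)]

theorem translationAtInfinity_slopeAddDecay_of_notMem {Y : Submodule ℝ X} {a : X} (ha : a ≠ 0)
    (haY : a ∉ Y) (v : C₀(X, ℂ)) :
    translationAtInfinity (direction a ha) (positionOp (slopeAddDecay Y) ∘L momentumOp v) =
      ((‖Y.mkQ a‖ / ‖a‖ : ℝ) : ℂ) • momentumOp v := by
  set c : ℂ := ((‖Y.mkQ a‖ / ‖a‖ : ℝ) : ℂ) with hc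
  have hconst : positionOp (c • (1 : X →ᵇ ℂ)) ∘L momentumOp v = c • momentumOp v := by
    rw [positionOp_smul]
    ext1 f
    simp only [ContinuousLinearMap.comp_apply, _root_.smul_apply]
    congr 1
    apply Lp.ext
    filter_upwards [coeFn_positionOp 1 (momentumOp v f)] with x hx
    rw [hx, show (1 : X →ᵇ ℂ) x = 1 from rfl, one_mul]
  rw [← hconst]
  refine (isTranslationAtInfinity_of_tendsto (fun b hb x => ?_) v).translationAtInfinity_eq
  refine tendsto_of_mem_halfLine (F := fun y => slopeAddDecay Y (x + y)) hb ?_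
  have h := (tendsto_slope (projection Y) (norm_ne_zero_iff.2 ha) x).add
    (tendsto_decayAcross haY x)
  rw [add_zero] at h
  rw [BoundedContinuousFunction.smul_apply, show (1 : X →ᵇ ℂ) x = 1 from rfl, smul_eq_mul, mul_one]
  exact h

theorem not_isCompact_translationAtInfinity_slopeAddDecay {Y : Submodule ℝ X} (hbot : Y ≠ ⊥)
    (htop : Y ≠ ⊤) {v : C₀(X, ℂ)} (hv : v ≠ 0) :
    ¬ IsCompact {B : hamiltonianAlgebra X | ∃ α : SphereAtInfinity X,
      (B : L2 X →L[ℂ] L2 X) =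
        translationAtInfinity α (positionOp (slopeAddDecay Y) ∘L momentumOp v)} := by
  intro hcomp
  obtain ⟨y, hyY, hy⟩ := Y.exists_mem_ne_zero_of_ne_bot hbot
  obtain ⟨e, heY⟩ : ∃ e, e ∉ Y := by
    by_contra! h
    exact htop (Submodule.eq_top_iff'.2 h)
  set A := positionOp (slopeAddDecay Y) ∘L momentumOp v with hA
  have hAmem : A ∈ hamiltonianAlgebra X :=
    positionOp_comp_momentumOp_mem (slopeAddDecay_mem Y) v
  -- Directions off `Y` converging to that of `y ∈ Y`: their limits `(‖π_Y (a n)‖ / ‖a n‖) v(p)`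
  -- tend to `0`.
  let a : ℕ → X := fun n => y + (1 / ((n : ℝ) + 1)) • e
  have haY (n : ℕ) : a n ∉ Y := by
    intro h
    have hpos : (1 / ((n : ℝ) + 1)) ≠ 0 := by positivity
    exact heY ((Y.smul_mem_iff hpos).1 ((Y.add_mem_iff_right hyY).1 h))
  have ha (n : ℕ) : a n ≠ 0 := fun h => haY n (h ▸ Y.zero_mem)
  have halim : Tendsto a atTop (𝓝 y) := by
    have := (tendsto_one_div_add_atTop_nhds_zero_nat (𝕜 := ℝ)).smul_const e |>.const_add y
    rwa [zero_smul, add_zero] at this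
  let B : ℕ → hamiltonianAlgebra X := fun n =>
    ⟨translationAtInfinity (direction (a n) (ha n)) A,
      (isHamiltonianLimit_translationAtInfinity hAmem _).1⟩
  have hB : Tendsto B atTop (𝓝 0) := by
    rw [tendsto_subtype_rng]
    simp only [B, hA, translationAtInfinity_slopeAddDecay_of_notMem (ha _) (haY _)]
    have h₁ : Tendsto (fun n => ‖Y.mkQ (a n)‖ / ‖a n‖) atTop (𝓝 (‖Y.mkQ y‖ / ‖y‖)) :=
      (((projection Y).continuous.norm.tendsto y).comp halim).div halim.norm
        (norm_ne_zero_iff.2 hy)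
    rw [norm_mkQ_eq_zero.2 hyY, zero_div] at h₁
    have h₂ := ((Complex.continuous_ofReal.tendsto 0).comp h₁).smul_const (momentumOp v)
    rwa [Complex.ofReal_zero, zero_smul] at h₂
  -- Compactness would make the set closed, so `0` would be attained in some direction; both cases
  -- below exclude this.
  obtain ⟨α, hα⟩ := hcomp.isClosed.mem_of_tendsto hB
    (Eventually.of_forall fun n => ⟨direction (a n) (ha n), rfl⟩)
  have hv' := momentumOp_ne_zero hv
  obtain ⟨_, b, hb, rfl⟩ := α
  change (0 : L2 X →L[ℂ] L2 X) = translationAtInfinity (direction b hb) A at hα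
  by_cases hbY : b ∈ Y
  · rw [hA, translationAtInfinity_slopeAddDecay_of_mem hb hbY] at hα
    exact hv' (ContinuousLinearMap.ext fun f =>
      positionOp_apply_eq_zero (decayAcross_ne_zero Y) (DFunLike.congr_fun hα f).symm)
  · rw [hA, translationAtInfinity_slopeAddDecay_of_notMem hb hbY] at hα
    refine (smul_ne_zero (Complex.ofReal_ne_zero.2 (div_ne_zero ?_ ?_)) hv') hα.symm
    · exact fun h => hbY (norm_mkQ_eq_zero.1 h)
    · exact norm_ne_zero_iff.2 hb

end Counterexample

theorem verticalAxis_ne_bot : verticalAxis ≠ ⊥ := by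
  intro h
  have hmem : EuclideanSpace.single (1 : Fin 2) (1 : ℝ) ∈ verticalAxis := by
    change EuclideanSpace.single (1 : Fin 2) (1 : ℝ) 0 = 0
    simp
  rw [h, Submodule.mem_bot] at hmem
  simpa using congrArg (fun x : EuclideanSpace ℝ (Fin 2) => x 1) hmem

theorem verticalAxis_ne_top : verticalAxis ≠ ⊤ := by
  intro h
  have hmem : EuclideanSpace.single (0 : Fin 2) (1 : ℝ) ∈ verticalAxis := h ▸ Submodule.mem_top
  have h0 : EuclideanSpace.single (0 : Fin 2) (1 : ℝ) 0 = 0 := hmem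
  simp at h0

end NBody

end

theorem mainTheorem12 :
    (∀ (X : Type*) [NormedAddCommGroup X] [InnerProductSpace ℝ X] [FiniteDimensional ℝ X]
        [MeasurableSpace X] [BorelSpace X],
      ∀ A ∈ NBody.hamiltonianAlgebra X,
        (∀ α : NBody.SphereAtInfinity X,
          NBody.IsTranslationAtInfinity α A (NBody.translationAtInfinity α A) ∧
            NBody.translationAtInfinity α A ∈ NBody.hamiltonianAlgebra X) ∧
        IsCompact (closure {B : NBody.hamiltonianAlgebra X |
          ∃ α : NBody.SphereAtInfinity X,
            (B : NBody.L2 X →L[ℂ] NBody.L2 X) = NBody.translationAtInfinity α A})) ∧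
    (∃ u₀ : EuclideanSpace ℝ (Fin 2) →ᵇ ℂ,
      (u₀ : EuclideanSpace ℝ (Fin 2) → ℂ) ∈
          NBody.sphericalFunctions (EuclideanSpace ℝ (Fin 2)) ∧
      ∃ uY ∈ NBody.quotientFunctions NBody.verticalAxis,
        ∀ v : C₀(EuclideanSpace ℝ (Fin 2), ℂ), v ≠ 0 →
          NBody.positionOp (u₀ + uY) ∘L NBody.momentumOp v ∈
              NBody.hamiltonianAlgebra (EuclideanSpace ℝ (Fin 2)) ∧
          ¬ IsCompact {B : NBody.hamiltonianAlgebra (EuclideanSpace ℝ (Fin 2)) |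
            ∃ α : NBody.SphereAtInfinity (EuclideanSpace ℝ (Fin 2)),
              (B : NBody.L2 (EuclideanSpace ℝ (Fin 2)) →L[ℂ]
                  NBody.L2 (EuclideanSpace ℝ (Fin 2))) =
                NBody.translationAtInfinity α
                  (NBody.positionOp (u₀ + uY) ∘L NBody.momentumOp v)}) := by
  refine ⟨fun X _ _ _ _ _ A hA =>
    ⟨fun α => (NBody.isHamiltonianLimit_translationAtInfinity hA α).symm,
      NBody.isCompact_closure_translationAtInfinity hA⟩,
    NBody.slope (NBody.projection NBody.verticalAxis),
    NBody.slope_mem_sphericalFunctions _ fun _ => norm_ne_zero_iff.2,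
    NBody.decayAcross NBody.verticalAxis, NBody.decayAcross_mem_quotientFunctions _,
    -- By definition, `slopeAddDecay` is the sum of the two witnesses.
    fun v hv => ⟨NBody.positionOp_comp_momentumOp_mem
      (NBody.slopeAddDecay_mem NBody.verticalAxis) v,
      NBody.not_isCompact_translationAtInfinity_slopeAddDecay NBody.verticalAxis_ne_bot
        NBody.verticalAxis_ne_top hv⟩⟩
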